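/- Let $S$ be a commutative cancellative monoid. $S$ is atomic if every nonunit is a finite product of atoms. For $a\in S$ let $\mathsf L(a)$ be the set of all $k$ such that $a$ is a product of $k$ atoms, and let $\Delta(a)$ be the set of differences of consecutive elements of $\mathsf L(a)$; for a monoid $M$ put $\Delta(M)=\bigcup_{a\in M}\Delta(a)$. If $\mathsf L(a)$ is finite with at least two elements, the length density of $a$ is $$\operatorname{LD}(a)=\frac{|\mathsf L(a)|-1}{\max\mathsf L(a)-\min\mathsf L(a)}.$$ Let $\mathcal Z(S)$ be the free abelian monoid on the atoms of $S_{\mathrm{red}}=S/S^\times$, with length function $|\cdot|$; let $\mathsf Z_S(a)\subseteq\mathcal Z(S)$ be the set of factorizations of $a$; and for $z,z'\in\mathcal Z(S)$ with $g=\gcd(z,z')$ let $\mathsf d(z,z')=\max\{|g^{-1}z|,|g^{-1}z'|\}$. For $a\in S$ and $w\in\mathcal Z(S)$ the tame degree $\mathsf t(a,w)$ is the smallest $N\in(\mathbb N_0\setminus\{1\})\cup\{\infty\}$ such that, if $\mathsf Z_S(a)\cap w\mathcal Z(S)\ne\emptyset$, then for every $z\in\mathsf Z_S(a)$ there is $z'\in\mathsf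 Z_S(a)\cap w\mathcal Z(S)$ with $\mathsf d(z,z')\le N$. For $A\subseteq S$ and $X\subseteq\mathcal Z(S)$ put $\mathsf t(A,X)=\sup\{\mathsf t(a,w): a\in A,\ w\in X\}$. $S$ is locally tame if $\mathsf t(S,\{u\})<\infty$ for every atom $u$ of $S_{\mathrm{red}}$. **Theorem.** Let $S$ be a locally tame atomic commutative cancellative monoid, let $x\in S$ with $\Delta(x)\neq\emptyset$, and let $H=\llbracket x\rrbracket$ be the submonoid of all elements of $S$ that divide some power of $x$. Suppose that $\Delta(H)$ is finite. Let $d=\min\Delta(H)$. Then there is a least $\tau$ with $d\in\Delta(x^\tau)$; the number $$\psi=\max\Big(\tau,\ \frac{\max\Delta(H)}{\min\Delta(H)}-1\Big)$$ is an integer; the tame degree $T=\mathsf t\big(H,\mathsf Z_S(x^\psi)\big)$ is finite (and is the same whether computed in $S$ or in the monoid $H$); for every $n\ge1$ the set $\mathsf L(x^n)$ is finite with at least two elements; and for all $n\ge\psi$ $$\frac1d-\frac{2T}{nd^2}\ \le\ \operatorname{LD}(x^n)\ \le\ \frac1d .$$ In particular, the asymptotic length density $\lim_{n\to\infty}\operatorname{LD}(x^n)$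 exists and equals $1/d$. -/

import Mathlib

noncomputable section

namespace Factorization

/-- The factorization monoid `Z(M)`: the free abelian monoid (finite multisets, written additively)
on the set of atoms of the reduced monoid `M_red = M / M^×`, which is `Associates M`. -/
abbrev FactMonoid (M : Type*) [CommMonoid M] : Type _ :=
  Multiset {p : Associates M // Irreducible p}

/-- `Z_M(a)`: the factorizations of `a`, that is, the `z ∈ Z(M)` whose product in `M_red` is the
class of `a`. -/
def factorizations {M : Type*} [CommMonoid M] (a : M) : Set (FactMonoid M) :=
  {z | (z.map Subtype.val).prod = Associates.mk a}

/-- `M` is atomic: every nonunit is a finite product of atoms. -/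
def IsAtomicMonoid (M : Type*) [CommMonoid M] : Prop :=
  ∀ a : M, ¬ IsUnit a → ∃ s : Multiset M, (∀ u ∈ s, Irreducible u) ∧ s.prod = a

/-- The set of lengths `L(a)`: all `k` such that `a` is a product of `k` atoms of `M`. -/
def lengthSet {M : Type*} [CommMonoid M] (a : M) : Set ℕ :=
  {k | ∃ s : Multiset M, (∀ u ∈ s, Irreducible u) ∧ s.prod = a ∧ Multiset.card s = k}

/-- The set of distances between consecutive elements of a set of natural numbers. -/
def distances (L : Set ℕ) : Set ℕ :=
  {δ | 0 < δ ∧ ∃ l ∈ L, l + δ ∈ L ∧ ∀ k ∈ L, ¬ (l < k ∧ k < l + δ)}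

/-- The delta set `Δ(a)` of an element. -/
def deltaSet {M : Type*} [CommMonoid M] (a : M) : Set ℕ :=
  distances (lengthSet a)

/-- The delta set `Δ(M) = ⋃_{a ∈ M} Δ(a)` of a monoid. -/
def monoidDeltaSet (M : Type*) [CommMonoid M] : Set ℕ :=
  ⋃ a : M, deltaSet a

/-- `max L(a) - min L(a)`, for an element `a` whose set of lengths is finite and nonempty. -/
def lengthSpread {M : Type*} [CommMonoid M] (a : M) : ℕ :=
  sSup (lengthSet a) - sInf (lengthSet a)

/-- The length density `(|L(a)| - 1) / (max L(a) - min L(a))`, for an element `a` whose set of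
lengths is finite and has at least two elements. -/
def lengthDensity {M : Type*} [CommMonoid M] (a : M) : ℝ :=
  (((lengthSet a).ncard : ℝ) - 1) / (lengthSpread a : ℝ)

/-- The elasticity `ρ(A) = max A / min A` of a finite nonempty set `A` of positive integers. -/
def setElasticity (A : Set ℕ) : ℝ :=
  ((sSup A : ℕ) : ℝ) / ((sInf A : ℕ) : ℝ)

open Classical in
/-- The distance in the factorization monoid: with `g = gcd(z, z')`,
`d(z, z') = max {|g⁻¹ z|, |g⁻¹ z'|}`. -/
def factDist {M : Type*} [CommMonoid M] (z z' : FactMonoid M) : ℕ :=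
  max (Multiset.card (z - z ∩ z')) (Multiset.card (z' - z ∩ z'))

/-- The tame degree `t(a, w)` of an element `a` with respect to `w ∈ Z(M)`: the smallest `N ≠ 1`
such that, if some factorization of `a` is a multiple of `w`, then every factorization of `a` has
distance at most `N` from one that is a multiple of `w` (and `⊤` if no finite `N` will do). -/
def elementTameDegree {M : Type*} [CommMonoid M] (a : M) (w : FactMonoid M) : ℕ∞ :=
  sInf {N : ℕ∞ | N ≠ 1 ∧
    ((∃ z ∈ factorizations a, w ≤ z) →
      ∀ z ∈ factorizations a, ∃ z' ∈ factorizations a, w ≤ z' ∧ (factDist z z' : ℕ∞) ≤ N)}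

/-- The tame degree `t(A, X) = sup {t(a, w) : a ∈ A, w ∈ X}` for `A ⊆ M` and `X ⊆ Z(M)`. -/
def tameDegree {M : Type*} [CommMonoid M] (A : Set M) (X : Set (FactMonoid M)) : ℕ∞ :=
  ⨆ a ∈ A, ⨆ w ∈ X, elementTameDegree a w

/-- `M` is locally tame: `t(M, u) < ∞` for every atom `u` (of `M_red`). -/
def IsLocallyTame (M : Type*) [CommMonoid M] : Prop :=
  ∀ u : {p : Associates M // Irreducible p},
    tameDegree (Set.univ : Set M) {({u} : FactMonoid M)} < ⊤

/-- `⟦x⟧`: the submonoid of all divisors of powers of `x`. -/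
def divisorClosure {M : Type*} [CommMonoid M] (x : M) : Submonoid M where
  carrier := {y | ∃ k : ℕ, y ∣ x ^ k}
  one_mem' := ⟨0, one_dvd _⟩
  mul_mem' := by
    rintro a b ⟨k, hk⟩ ⟨l, hl⟩
    exact ⟨k + l, by rw [pow_add]; exact mul_dvd_mul hk hl⟩

theorem self_mem_divisorClosure {M : Type*} [CommMonoid M] (x : M) : x ∈ divisorClosure x :=
  ⟨1, by rw [pow_one]⟩

end Factorization

end

/-!
Write `L(k)` for the set of lengths of `x ^ k` and `H` for the divisor closure of `x`. Three facts
about these sets carry the proof.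

* The minimum `d` of `Δ(H)` divides all of `Δ(H)` (`dvd_of_isLeast_distances`), and occurs in a
  power of `x` (`exists_mem_deltaSet_pow`). Hence `max Δ(H) = m * d` for an integer `m`, and the
  upper bound `1 / d` for the length density is immediate (`density_le`).
* In a locally tame monoid the lengths of factorizations of an element are bounded, and the tame
  degree with respect to all factorizations of a fixed element is finite
  (`IsLocallyTame.exists_card_le`, `IsLocallyTame.tameDegree_factorizations_ne_top`). In terms of
  lengths, the tame degree `T` says: for `w ∈ L(ψ)`, every element of `L(ψ + k)` differs
  by at most `T` from some `w + j` with `j ∈ L(k)` (`isTame_pow`).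
* `L(a) + L(b) ⊆ L(a + b)` (`isLengthFamily_pow`).

The lower bound is a statement about sets of natural numbers with these properties. Let `σ * d` be a
distance in `L(1)`, so that `L(n)` spreads over at least `n * σ * d`. One may therefore lose `σ * T`
at each end of `L(n)`, which allows for `σ` tame steps. In `σ - 1` factors `x ^ ψ` there is a
factorization that can be lengthened by `d`, because `τ ≤ ψ`; in one more factor `x ^ ψ` there is
one that can be lengthened `ψ` times by `σ * d`. Together they yield an arithmetic progression with
difference `d` and `(ψ + 1) * σ` terms in `L(σ * ψ)`. As `ψ + 1 ≥ m`, it fills all gaps when added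
to `L(n - σ * ψ)` (`exists_add_mul_of_distances_le`), and by the tame steps the result comes
within `σ * T` of either end of `L(n)` (`IsLengthFamily.csSup_sub_csInf_le`). If `n < σ * ψ`, the
lower bound is at most `0` since `T ≥ max L(ψ) - min L(ψ)` (`IsLengthFamily.le_density`).

The delta sets and tame degrees of `H` as a monoid of its own are those computed in `S`, because the
factorizations of an element of a divisor-closed submonoid are the same in both monoids
(`IsDivisorClosed.factorizations_coe`).
-/

namespace Factorization

/-! ### Distances in sets of natural numbers -/

theorem exists_mem_distances_le {L : Set ℕ} {l r : ℕ} (hl : l ∈ L) (hr : 0 < r) (h : l + r ∈ L) :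
    ∃ δ ∈ distances L, δ ≤ r ∧ l + δ ∈ L := by
  classical
  have hex : ∃ δ, 0 < δ ∧ l + δ ∈ L := ⟨r, hr, h⟩
  obtain ⟨hpos, hmem⟩ := Nat.find_spec hex
  refine ⟨Nat.find hex, ⟨hpos, l, hl, hmem, ?_⟩, Nat.find_min' hex ⟨hr, h⟩, hmem⟩
  rintro k hk ⟨h1, h2⟩
  refine Nat.find_min hex (m := k - l) (by omega) ⟨by omega, ?_⟩
  rwa [Nat.add_sub_cancel' h1.le]

theorem dvd_of_dvd_distances {L : Set ℕ} {d : ℕ} (hd : ∀ δ ∈ distances L, d ∣ δ) :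
    ∀ {r l : ℕ}, l ∈ L → l + r ∈ L → d ∣ r := by
  intro r
  induction r using Nat.strong_induction_on with
  | _ r ih =>
    intro l hl hlr
    rcases Nat.eq_zero_or_pos r with rfl | hr
    · exact dvd_zero d
    obtain ⟨δ, hδ, hle, hmem⟩ := exists_mem_distances_le hl hr hlr
    have hδ0 : 0 < δ := hδ.1
    have := ih (r - δ) (by omega) hmem (by rwa [add_assoc, Nat.add_sub_cancel' hle])
    simpa [Nat.sub_add_cancel hle] using dvd_add this (hd δ hδ)

/-- A set whose distances are multiples of `d` bounded by `(M + 1) * d` becomes an uninterrupted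
arithmetic progression with difference `d` once it is added to `{0, d, …, M * d}`. -/
theorem exists_add_mul_of_distances_le {K : Set ℕ} {d M a r : ℕ} (hd : 0 < d)
    (hdvd : ∀ δ ∈ distances K, d ∣ δ) (hle : ∀ δ ∈ distances K, δ ≤ (M + 1) * d)
    (ha : a ∈ K) (har : a + r ∈ K) (t : ℕ) (ht : t * d ≤ r + M * d) :
    ∃ k ∈ K, ∃ i ≤ M, a + t * d = k + i * d := by
  induction t with
  | zero => exact ⟨a, ha, 0, Nat.zero_le _, by simp⟩
  | succ t ih =>
    obtain ⟨k, hk, i, hi, h⟩ := ih (by rw [Nat.succ_mul] at ht; omega)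
    rcases hi.lt_or_eq with hi | rfl
    · exact ⟨k, hk, i + 1, hi, by rw [Nat.succ_mul, Nat.succ_mul]; omega⟩
    rw [Nat.succ_mul] at ht
    have hlt : k < a + r := by omega
    obtain ⟨δ, hδ, -, hmem⟩ := exists_mem_distances_le (r := a + r - k) hk (by omega)
      (by rwa [Nat.add_sub_cancel' hlt.le])
    obtain ⟨q, rfl⟩ := hdvd δ hδ
    have hq : q ≤ i + 1 := by
      have := hle _ hδ
      rw [mul_comm] at this
      exact Nat.le_of_mul_le_mul_right this hd
    have hq0 : 0 < q := Nat.pos_of_mul_pos_left hδ.1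
    obtain ⟨c, hc⟩ := Nat.exists_eq_add_of_le hq
    refine ⟨k + d * q, hmem, c, by omega, ?_⟩
    have : (i + 1) * d = d * q + c * d := by rw [hc]; ring
    rw [Nat.succ_mul] at this ⊢
    omega

theorem ncard_sub_one_mul_le {A : Set ℕ} {d : ℕ} (hd : 0 < d) (hfin : A.Finite)
    (hdvd : ∀ δ ∈ distances A, d ∣ δ) : (A.ncard - 1) * d ≤ sSup A - sInf A := by
  rcases A.eq_empty_or_nonempty with rfl | hne
  · simp
  have hsub : A ⊆ (fun t => sInf A + t * d) ''
      (Finset.range ((sSup A - sInf A) / d + 1) : Set ℕ) := by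
    intro a ha
    have h1 : sInf A ≤ a := Nat.sInf_le ha
    have h2 : a ≤ sSup A := le_csSup hfin.bddAbove ha
    obtain ⟨t, ht⟩ := dvd_of_dvd_distances hdvd (Nat.sInf_mem hne) (r := a - sInf A)
      (by rwa [Nat.add_sub_cancel' h1])
    refine ⟨t, ?_, ?_⟩
    · rw [Finset.coe_range, Set.mem_Iio, Nat.lt_succ_iff, Nat.le_div_iff_mul_le hd, mul_comm,
        ← ht]
      omega
    · change sInf A + t * d = a
      rw [mul_comm, ← ht, Nat.add_sub_cancel' h1]
  have hc := (Set.ncard_le_ncard hsub ((Finset.finite_toSet _).image _)).trans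
    (Set.ncard_image_le (Finset.finite_toSet _))
  rw [Set.ncard_coe_finset, Finset.card_range] at hc
  exact (Nat.mul_le_mul_right d (Nat.sub_le_iff_le_add.2 hc)).trans (Nat.div_mul_le_self _ d)

theorem density_le {A : Set ℕ} {d : ℕ} (hd : 0 < d) (hfin : A.Finite)
    (hne : A.Nonempty) (hpos : 0 < sSup A - sInf A) (hdvd : ∀ δ ∈ distances A, d ∣ δ) :
    ((A.ncard : ℝ) - 1) / ((sSup A - sInf A : ℕ) : ℝ) ≤ 1 / d := by
  have hcard : 1 ≤ A.ncard := (Set.ncard_pos hfin).2 hne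
  have h := ncard_sub_one_mul_le hd hfin hdvd
  rw [div_le_div_iff₀ (by exact_mod_cast hpos) (by exact_mod_cast hd), one_mul,
    ← Nat.cast_one, ← Nat.cast_sub hcard]
  exact_mod_cast h

/-! ### Lengths of the powers of one element -/

/-- The additive behaviour of the sets of lengths of the powers of one element: `L k` stands for
the set of lengths of the `k`-th power. -/
structure IsLengthFamily (L : ℕ → Set ℕ) : Prop where
  zero : L 0 = {0}
  add : ∀ {a b i j : ℕ}, i ∈ L a → j ∈ L b → i + j ∈ L (a + b)

namespace IsLengthFamily

variable {L : ℕ → Set ℕ}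

/-- Sums of `v` numbers chosen from `q` and `q + c`. -/
theorem mul_add_mul_mem (hL : IsLengthFamily L) {u q c : ℕ} (hq : q ∈ L u) (hc : q + c ∈ L u) :
    ∀ {v i : ℕ}, i ≤ v → v * q + i * c ∈ L (v * u) := by
  intro v
  induction v with
  | zero =>
    intro i hi
    obtain rfl : i = 0 := by omega
    simp [hL.zero]
  | succ v ih =>
    intro i hi
    rw [Nat.succ_mul v u]
    rcases Nat.lt_or_ge v i with h | h
    · obtain rfl : i = v + 1 := by omega
      convert hL.add (ih le_rfl) hc using 1
      ring
    · convert hL.add (ih h) hq using 1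
      ring

theorem mul_mem (hL : IsLengthFamily L) {u q : ℕ} (hq : q ∈ L u) (v : ℕ) : v * q ∈ L (v * u) := by
  simpa using hL.mul_add_mul_mem (c := 0) hq hq (Nat.zero_le v)

/-- `T` bounds the tame degree of the family with respect to the `ψ`-th member: every length in
`L (ψ + k)` is, up to `T`, the sum of a prescribed length in `L ψ` and some length in `L k`. -/
def IsTame (L : ℕ → Set ℕ) (ψ T : ℕ) : Prop :=
  ∀ ⦃k w l : ℕ⦄, w ∈ L ψ → l ∈ L (ψ + k) → ∃ j ∈ L k, w + j ≤ l + T ∧ l ≤ w + j + T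

theorem IsTame.iterate {ψ T : ℕ} (hT : IsTame L ψ T) {w : ℕ} (hw : w ∈ L ψ) (s : ℕ) :
    ∀ {k l : ℕ}, l ∈ L (s * ψ + k) →
      ∃ j ∈ L k, s * w + j ≤ l + s * T ∧ l ≤ s * w + j + s * T := by
  induction s with
  | zero => intro k l hl; exact ⟨l, by simpa using hl, by simp⟩
  | succ s ih =>
    intro k l hl
    have e : (s + 1) * ψ + k = ψ + (s * ψ + k) := by ring
    rw [e] at hl
    obtain ⟨j, hj, h1, h2⟩ := hT hw hl
    obtain ⟨j', hj', h3, h4⟩ := ih hj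
    refine ⟨j', hj', ?_, ?_⟩ <;> simp only [Nat.succ_mul] <;> omega

/-- The spread `max (L n) - min (L n)` grows at least linearly in `n`, as seen from the sums of `n`
equal summands. -/
theorem le_csSup_sub_csInf (hL : IsLengthFamily L) (hfin : ∀ k, (L k).Finite) {p c : ℕ}
    (hp : p ∈ L 1) (hpc : p + c ∈ L 1) (n : ℕ) : n * c ≤ sSup (L n) - sInf (L n) := by
  have h1 := Nat.sInf_le (by simpa using hL.mul_mem hp n : n * p ∈ L n)
  have h2 := le_csSup (hfin n).bddAbove (by simpa using hL.mul_mem hpc n : n * (p + c) ∈ L n)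
  rw [mul_add] at h2
  omega

/-- Every element of `L ψ` is within `T` of any other: take `k = 0` in `IsTame`. -/
theorem IsTame.csSup_sub_csInf_le (hL : IsLengthFamily L) (hfin : ∀ k, (L k).Finite)
    (hne : ∀ k, (L k).Nonempty) {ψ T : ℕ} (hT : IsTame L ψ T) :
    sSup (L ψ) - sInf (L ψ) ≤ T := by
  obtain ⟨j, hj, -, h⟩ := hT (k := 0) (Nat.sInf_mem (hne ψ))
    (Nat.sSup_mem (hne ψ) (hfin ψ).bddAbove)
  rw [hL.zero] at hj
  obtain rfl : j = 0 := hj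
  rw [add_zero ψ] at h
  omega

/-- Up to `σ * T` at either end, `L n` contains an uninterrupted arithmetic progression with
difference `d`, so that its cardinality is close to the largest one possible. -/
theorem csSup_sub_csInf_le (hL : IsLengthFamily L) (hfin : ∀ k, (L k).Finite)
    (hne : ∀ k, (L k).Nonempty) {d m σ τ ψ T p l n : ℕ} (hd : 0 < d) (hσ : 0 < σ)
    (hdvd : ∀ k, ∀ δ ∈ distances (L k), d ∣ δ) (hle : ∀ k, ∀ δ ∈ distances (L k), δ ≤ m * d)
    (hp : p ∈ L 1) (hpσ : p + σ * d ∈ L 1) (hl : l ∈ L τ) (hld : l + d ∈ L τ)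
    (hτ : τ ≤ ψ) (hm : m ≤ ψ + 1) (hT : IsTame L ψ T) (hn : σ * ψ ≤ n) :
    sSup (L n) - sInf (L n) ≤ ((L n).ncard - 1) * d + 2 * σ * T := by
  obtain ⟨s, rfl⟩ : ∃ s, σ = s + 1 := ⟨σ - 1, by omega⟩
  obtain ⟨k, rfl⟩ := Nat.exists_eq_add_of_le hn
  obtain ⟨g, rfl⟩ := Nat.exists_eq_add_of_le hτ
  -- A factorization of the `(τ + g)`-th power that can be lengthened by `d`,
  -- and one that can be lengthened in steps of `σ * d`.
  set ψ := τ + g with hψ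
  set a := l + g * p with ha_def
  have ha : a ∈ L ψ := hL.add hl (by simpa using hL.mul_mem hp g)
  have had : a + d ∈ L ψ := by
    have := hL.add hld (by simpa using hL.mul_mem hp g)
    rwa [add_right_comm] at this
  have hb : ∀ i ≤ ψ, ψ * p + i * ((s + 1) * d) ∈ L ψ := fun i hi => by
    simpa using hL.mul_add_mul_mem hp hpσ hi
  set M := ψ * (s + 1) + s with hM
  set base := ψ * p + s * a with hbase
  -- Write `i = σ * i₁ + i₀` with `σ = s + 1`: use `i₁` long steps and `i₀` short ones.
  have hAP : ∀ i ≤ M, base + i * d ∈ L ((s + 1) * ψ) := by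
    intro i hi
    have h1 : i / (s + 1) ≤ ψ := by
      rw [← Nat.lt_succ_iff, Nat.div_lt_iff_lt_mul (Nat.succ_pos s)]
      have : (ψ + 1) * (s + 1) = M + 1 := by rw [hM]; ring
      change i < (ψ + 1) * (s + 1)
      omega
    have h2 : i % (s + 1) ≤ s := Nat.lt_succ_iff.1 (Nat.mod_lt _ (Nat.succ_pos s))
    have h3 := hL.add (hb _ h1) (hL.mul_add_mul_mem ha had h2)
    have e1 : ψ + s * ψ = (s + 1) * ψ := by ring
    rw [e1] at h3
    convert h3 using 1
    conv_lhs => rw [← Nat.div_add_mod i (s + 1)]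
    rw [hbase]
    ring
  have hsplit : (s + 1) * ψ + k = ψ + (s * ψ + k) := by ring
  -- The lower end of the progression.
  obtain ⟨e, he, hmin⟩ : ∃ e ∈ L k, base + e ≤ sInf (L ((s + 1) * ψ + k)) + (s + 1) * T := by
    obtain ⟨j, hj, h1, -⟩ := hT (k := s * ψ + k) (hb 0 (Nat.zero_le _))
      (by rw [← hsplit]; exact Nat.sInf_mem (hne _))
    obtain ⟨e, he, h2, -⟩ := hT.iterate ha s hj
    exact ⟨e, he, by rw [hbase, Nat.succ_mul s T]; omega⟩
  -- The upper end of the progression.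
  obtain ⟨e', he', hmax⟩ : ∃ e' ∈ L k,
      sSup (L ((s + 1) * ψ + k)) ≤ base + e' + M * d + (s + 1) * T := by
    obtain ⟨j, hj, -, h1⟩ := hT (k := s * ψ + k) (hb ψ le_rfl)
      (by rw [← hsplit]; exact Nat.sSup_mem (hne _) (hfin _).bddAbove)
    obtain ⟨e, he, -, h2⟩ := hT.iterate had s hj
    refine ⟨e, he, ?_⟩
    have e1 : M * d = ψ * ((s + 1) * d) + s * d := by rw [hM]; ring
    rw [hbase, Nat.succ_mul s T, e1]
    rw [mul_add] at h2
    omega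
  obtain ⟨r, hr, hmax⟩ : ∃ r, e + r ∈ L k ∧
      sSup (L ((s + 1) * ψ + k)) ≤ base + (e + r) + M * d + (s + 1) * T := by
    rcases le_total e e' with h | h
    · exact ⟨e' - e, by rwa [Nat.add_sub_cancel' h], by rwa [Nat.add_sub_cancel' h]⟩
    · exact ⟨0, he, by omega⟩
  obtain ⟨q, rfl⟩ := dvd_of_dvd_distances (hdvd k) he hr
  have hmM : m ≤ M + 1 := by
    have : ψ ≤ ψ * (s + 1) := Nat.le_mul_of_pos_right _ (Nat.succ_pos s)
    omega
  have hsub : (fun t => base + e + t * d) '' (Finset.range (q + M + 1) : Set ℕ) ⊆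
      L ((s + 1) * ψ + k) := by
    rintro _ ⟨t, ht, rfl⟩
    rw [Finset.coe_range, Set.mem_Iio, Nat.lt_succ_iff] at ht
    obtain ⟨k', hk', i, hi, h⟩ := exists_add_mul_of_distances_le (M := M) hd (hdvd k)
      (fun δ hδ => (hle k δ hδ).trans (Nat.mul_le_mul_right d hmM)) he hr t
      (by rw [mul_comm d q, ← add_mul]; exact Nat.mul_le_mul_right d ht)
    have e1 : base + e + t * d = base + i * d + k' := by omega
    change base + e + t * d ∈ _
    rw [e1]
    exact hL.add (hAP i hi) hk'
  have hcard : q + M + 1 ≤ (L ((s + 1) * ψ + k)).ncard := by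
    have := Set.ncard_le_ncard hsub (hfin _)
    rwa [Set.ncard_image_of_injective _
      (fun t t' h => Nat.eq_of_mul_eq_mul_right hd (Nat.add_left_cancel h)),
      Set.ncard_coe_finset, Finset.card_range] at this
  have hcard' : (q + M) * d ≤ ((L ((s + 1) * ψ + k)).ncard - 1) * d :=
    Nat.mul_le_mul_right d (by omega)
  have e1 : (q + M) * d = d * q + M * d := by ring
  have e2 : 2 * (s + 1) * T = (s + 1) * T + (s + 1) * T := by ring
  omega

/-- The lower bound for the length density. If `n < σ * ψ` it is at most `0`, because
`T` is at least the difference between the largest and the smallest element of `L ψ`. -/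
theorem le_density (hL : IsLengthFamily L) (hfin : ∀ k, (L k).Finite)
    (hne : ∀ k, (L k).Nonempty) {d m σ τ ψ T p l n : ℕ} (hd : 0 < d) (hσ : 0 < σ)
    (hdvd : ∀ k, ∀ δ ∈ distances (L k), d ∣ δ) (hle : ∀ k, ∀ δ ∈ distances (L k), δ ≤ m * d)
    (hp : p ∈ L 1) (hpσ : p + σ * d ∈ L 1) (hl : l ∈ L τ) (hld : l + d ∈ L τ)
    (hτ : τ ≤ ψ) (hm : m ≤ ψ + 1) (hT : IsTame L ψ T) (hn : 0 < n) :
    1 / (d : ℝ) - 2 * (T : ℝ) / ((n : ℝ) * (d : ℝ) ^ 2) ≤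
      (((L n).ncard : ℝ) - 1) / ((sSup (L n) - sInf (L n) : ℕ) : ℝ) := by
  have hd' : (0 : ℝ) < d := by exact_mod_cast hd
  have hn' : (0 : ℝ) < n := by exact_mod_cast hn
  have hσ' : (0 : ℝ) < σ := by exact_mod_cast hσ
  have hcard : 1 ≤ (L n).ncard := (Set.ncard_pos (hfin n)).2 (hne n)
  have hcard' : (1 : ℝ) ≤ (L n).ncard := by exact_mod_cast hcard
  have hN := hL.le_csSup_sub_csInf hfin hp hpσ n
  rcases Nat.lt_or_ge n (σ * ψ) with h | h
  · have h1 : n * d ≤ T := calc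
      n * d ≤ σ * ψ * d := Nat.mul_le_mul_right d h.le
      _ = ψ * (σ * d) := by ring
      _ ≤ _ := hL.le_csSup_sub_csInf hfin hp hpσ ψ
      _ ≤ T := hT.csSup_sub_csInf_le hL hfin hne
    have h1' : (n : ℝ) * d ≤ T := by exact_mod_cast h1
    refine le_trans ?_ (div_nonneg (sub_nonneg.2 hcard') (Nat.cast_nonneg _))
    rw [sub_nonpos, div_le_div_iff₀ hd' (by positivity)]
    nlinarith [mul_le_mul_of_nonneg_right h1' hd'.le,
      mul_nonneg (Nat.cast_nonneg T : (0 : ℝ) ≤ T) hd'.le]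
  · have key := hL.csSup_sub_csInf_le hfin hne hd hσ hdvd hle hp hpσ hl hld hτ hm hT h
    set N := sSup (L n) - sInf (L n) with hNdef
    have hN' : (n : ℝ) * (σ * d) ≤ N := by exact_mod_cast hN
    have hNpos : (0 : ℝ) < N := lt_of_lt_of_le (by positivity) hN'
    have key' : (N : ℝ) ≤ ((L n).ncard - 1) * d + 2 * σ * T := by
      have : (N : ℝ) ≤ (((L n).ncard - 1 : ℕ) : ℝ) * d + 2 * σ * T := by exact_mod_cast key
      rwa [Nat.cast_sub hcard, Nat.cast_one] at this
    have h1 : 2 * (T : ℝ) * σ / (N * d) ≤ 2 * (T : ℝ) / ((n : ℝ) * (d : ℝ) ^ 2) := by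
      rw [div_le_div_iff₀ (by positivity) (by positivity)]
      calc 2 * (T : ℝ) * σ * (n * d ^ 2) = 2 * T * (n * (σ * d)) * d := by ring
        _ ≤ 2 * T * N * d := by gcongr
        _ = _ := by ring
    have h2 : 1 / (d : ℝ) - 2 * (T : ℝ) * σ / (N * d) ≤ ((L n).ncard - 1) / (N : ℝ) := by
      have : 1 / (d : ℝ) - 2 * (T : ℝ) * σ / (N * d) = (N - 2 * T * σ) / (N * d) := by
        field_simp
      rw [this, div_le_div_iff₀ (by positivity) hNpos]
      calc (N - 2 * T * σ) * (N : ℝ) ≤ ((L n).ncard - 1) * d * N := by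
            gcongr; linarith
        _ = _ := by ring
    linarith

end IsLengthFamily

/-! ### Factorizations and their lengths -/

section CommMonoid

variable {M : Type*} [CommMonoid M]

theorem irreducible_associates_mk {a : M} : Irreducible (Associates.mk a) ↔ Irreducible a := by
  simp only [irreducible_iff, Associates.isUnit_mk, Associates.forall_associated,
    Associates.mk_mul_mk, Associates.mk_eq_mk_iff_associated, Associated.comm (x := a)]
  apply Iff.rfl.and
  constructor
  · rintro h x y rfl
    exact h _ _ <| .refl _
  · rintro h x y ⟨u, rfl⟩
    simpa using h (mul_assoc _ _ _)

/-- The lengths of the factorizations of `a` in the reduced monoid. In contrast to `lengthSet a`,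
this set is also nonempty (namely `{0}`) when `a` is a unit different from `1`. -/
def factorizationLengths (a : M) : Set ℕ :=
  Multiset.card '' factorizations a

theorem mem_factorizations {a : M} {z : FactMonoid M} :
    z ∈ factorizations a ↔ (z.map Subtype.val).prod = Associates.mk a :=
  Iff.rfl

theorem add_mem_factorizations {a b : M} {z w : FactMonoid M} (hz : z ∈ factorizations a)
    (hw : w ∈ factorizations b) : z + w ∈ factorizations (a * b) := by
  rw [mem_factorizations] at *
  rw [Multiset.map_add, Multiset.prod_add, hz, hw, Associates.mk_mul_mk]

theorem exists_mem_factorizations (z : FactMonoid M) : ∃ a : M, z ∈ factorizations a := by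
  obtain ⟨a, ha⟩ := Associates.mk_surjective (z.map Subtype.val).prod
  exact ⟨a, ha.symm⟩

theorem add_mem_factorizationLengths {a b : M} {i j : ℕ} (hi : i ∈ factorizationLengths a)
    (hj : j ∈ factorizationLengths b) : i + j ∈ factorizationLengths (a * b) := by
  obtain ⟨z, hz, rfl⟩ := hi
  obtain ⟨w, hw, rfl⟩ := hj
  exact ⟨z + w, add_mem_factorizations hz hw, Multiset.card_add z w⟩

theorem exists_mem_factorizations_prod (s : Multiset M) (hs : ∀ u ∈ s, Irreducible u) :
    ∃ z ∈ factorizations s.prod, Multiset.card z = Multiset.card s := by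
  refine ⟨s.pmap (fun p hp => ⟨Associates.mk p, irreducible_associates_mk.2 hp⟩) hs, ?_,
    Multiset.card_pmap _ _ _⟩
  rw [mem_factorizations, Multiset.map_pmap, Multiset.pmap_eq_map, Associates.prod_mk]

theorem lengthSet_subset (a : M) : lengthSet a ⊆ factorizationLengths a := by
  rintro _ ⟨s, hs, rfl, rfl⟩
  exact exists_mem_factorizations_prod s hs

/-- Choosing representatives of the atoms in a factorization gives a product that agrees with `a`
up to a unit, and one of the atoms can absorb this unit. -/
theorem lengthSet_eq_of_not_isUnit {a : M} (ha : ¬ IsUnit a) :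
    lengthSet a = factorizationLengths a := by
  refine (lengthSet_subset a).antisymm ?_
  rintro _ ⟨z, hz, rfl⟩
  set s : Multiset M := z.map fun p => Quot.out p.val with hs
  have hirr : ∀ u ∈ s, Irreducible u := by
    intro u hu
    obtain ⟨p, -, rfl⟩ := Multiset.mem_map.1 hu
    exact irreducible_associates_mk.1 ((Associates.quot_out p.val).symm ▸ p.2)
  have hprod : Associates.mk s.prod = Associates.mk a := by
    rw [← Associates.prod_mk, hs, Multiset.map_map, ← hz]
    congr 1
    exact Multiset.map_congr rfl fun p _ => Associates.quot_out p.val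
  obtain ⟨u, hu⟩ := Associates.mk_eq_mk_iff_associated.1 hprod
  have hcard : Multiset.card s = Multiset.card z := Multiset.card_map _ _
  clear_value s
  rcases s.empty_or_exists_mem with rfl | ⟨b, hb⟩
  · exact absurd ⟨u, by simpa using hu⟩ ha
  obtain ⟨t, rfl⟩ := Multiset.exists_cons_of_mem hb
  refine ⟨(b * u) ::ₘ t, ?_, ?_, by simpa using hcard⟩
  · intro v hv
    rcases Multiset.mem_cons.1 hv with rfl | hv
    · exact (irreducible_mul_units u).2 (hirr b hb)
    · exact hirr v (Multiset.mem_cons_of_mem hv)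
  · rw [← hu, Multiset.prod_cons, Multiset.prod_cons, mul_right_comm]

theorem eq_zero_of_mem_factorizations {a : M} (ha : IsUnit a) {z : FactMonoid M}
    (hz : z ∈ factorizations a) : z = 0 := by
  refine Multiset.eq_zero_of_forall_notMem fun p hp => p.2.not_isUnit ?_
  refine isUnit_of_dvd_unit (Multiset.dvd_prod (Multiset.mem_map_of_mem _ hp)) ?_
  rw [mem_factorizations.1 hz]
  exact Associates.isUnit_mk.2 ha

theorem factorizationLengths_of_isUnit {a : M} (ha : IsUnit a) : factorizationLengths a = {0} := by
  refine Set.eq_singleton_iff_unique_mem.2 ⟨⟨0, ?_, rfl⟩, ?_⟩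
  · rw [mem_factorizations, Multiset.map_zero, Multiset.prod_zero]
    exact (Associates.mk_eq_one.2 ha).symm
  · rintro _ ⟨z, hz, rfl⟩
    rw [eq_zero_of_mem_factorizations ha hz, Multiset.card_zero]

theorem lengthSet_one : lengthSet (1 : M) = factorizationLengths (1 : M) := by
  refine (lengthSet_subset 1).antisymm ?_
  rw [factorizationLengths_of_isUnit isUnit_one]
  rintro _ rfl
  exact ⟨0, by simp⟩

theorem distances_eq_empty_of_subset {A : Set ℕ} (hA : A ⊆ {0}) : distances A = ∅ := by
  refine Set.eq_empty_of_forall_notMem fun δ ⟨h, l, _, h2, _⟩ => ?_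
  have : l + δ = 0 := hA h2
  omega

theorem deltaSet_eq (a : M) : deltaSet a = distances (factorizationLengths a) := by
  by_cases ha : IsUnit a
  · have h := factorizationLengths_of_isUnit ha
    rw [deltaSet, h, distances_eq_empty_of_subset (h ▸ lengthSet_subset a),
      distances_eq_empty_of_subset subset_rfl]
  · rw [deltaSet, lengthSet_eq_of_not_isUnit ha]

theorem not_isUnit_of_deltaSet_nonempty {a : M} (h : (deltaSet a).Nonempty) : ¬ IsUnit a := by
  intro ha
  rw [deltaSet_eq, factorizationLengths_of_isUnit ha, distances_eq_empty_of_subset subset_rfl] at h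
  exact Set.not_nonempty_empty h

theorem lengthSet_pow {x : M} (hx : ¬ IsUnit x) (n : ℕ) :
    lengthSet (x ^ n) = factorizationLengths (x ^ n) := by
  rcases Nat.eq_zero_or_pos n with rfl | hn
  · rw [pow_zero, lengthSet_one]
  · exact lengthSet_eq_of_not_isUnit fun h => hx ((isUnit_pow_iff hn.ne').1 h)

theorem factorizations_nonempty (h : IsAtomicMonoid M) (a : M) : (factorizations a).Nonempty := by
  by_cases ha : IsUnit a
  · refine ⟨0, ?_⟩
    rw [mem_factorizations, Multiset.map_zero, Multiset.prod_zero]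
    exact (Associates.mk_eq_one.2 ha).symm
  · obtain ⟨s, hs, rfl⟩ := h a ha
    obtain ⟨z, hz, -⟩ := exists_mem_factorizations_prod s hs
    exact ⟨z, hz⟩

theorem isLengthFamily_pow (x : M) : IsLengthFamily fun k => factorizationLengths (x ^ k) where
  zero := by rw [pow_zero]; exact factorizationLengths_of_isUnit isUnit_one
  add hi hj := by rw [pow_add]; exact add_mem_factorizationLengths hi hj

/-! ### The distance of factorizations and tame degrees -/

open Classical in
theorem factDist_eq (z z' : FactMonoid M) :
    factDist z z' = max (Multiset.card (z - z')) (Multiset.card (z' - z)) := by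
  have h : ∀ a b : FactMonoid M, a - a ∩ b = a - b := fun a b => by
    ext p
    simp only [Multiset.count_sub, Multiset.count_inter]
    omega
  rw [factDist, h, Multiset.inter_comm, h]

open Classical in
theorem factDist_triangle (z₁ z₂ z₃ : FactMonoid M) :
    factDist z₁ z₃ ≤ factDist z₁ z₂ + factDist z₂ z₃ := by
  have h : ∀ a b c : FactMonoid M,
      Multiset.card (a - c) ≤ Multiset.card (a - b) + Multiset.card (b - c) := fun a b c => by
    rw [← Multiset.card_add]
    exact Multiset.card_le_card tsub_le_tsub_add_tsub
  have h1 := h z₁ z₂ z₃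
  have h2 := h z₃ z₂ z₁
  simp only [factDist_eq]
  omega

theorem factDist_add_left (u z z' : FactMonoid M) : factDist (u + z) (u + z') = factDist z z' := by
  classical
  simp only [factDist_eq, add_tsub_add_eq_tsub_left]

theorem factDist_le_max_card (z z' : FactMonoid M) :
    factDist z z' ≤ max (Multiset.card z) (Multiset.card z') := by
  classical
  rw [factDist_eq]
  exact max_le_max (Multiset.card_le_card tsub_le_self) (Multiset.card_le_card tsub_le_self)

theorem card_le_card_add_factDist (z z' : FactMonoid M) :
    Multiset.card z ≤ Multiset.card z' + factDist z z' ∧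
      Multiset.card z' ≤ Multiset.card z + factDist z z' := by
  classical
  have h : ∀ a b : FactMonoid M, Multiset.card a ≤ Multiset.card b + Multiset.card (a - b) :=
    fun a b => by
      rw [← Multiset.card_add]
      exact Multiset.card_le_card le_add_tsub
  have h1 := h z z'
  have h2 := h z' z
  rw [factDist_eq]
  omega

/-- `N` bounds the tame degree `t(a, w)`, without the convention that tame degrees are never `1`. -/
def IsTameBound (a : M) (w : FactMonoid M) (N : ℕ∞) : Prop :=
  (∃ z ∈ factorizations a, w ≤ z) →
    ∀ z ∈ factorizations a, ∃ z' ∈ factorizations a, w ≤ z' ∧ (factDist z z' : ℕ∞) ≤ N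

theorem isTameBound_of_elementTameDegree_le {a : M} {w : FactMonoid M} {N : ℕ∞}
    (h : elementTameDegree a w ≤ N) : IsTameBound a w N := by
  have hne : {N : ℕ∞ | N ≠ 1 ∧ IsTameBound a w N}.Nonempty :=
    ⟨⊤, by simp, fun ⟨z₀, hz₀, hw⟩ _ _ => ⟨z₀, hz₀, hw, le_top⟩⟩
  intro hw z hz
  obtain ⟨z', hz', hw', hd⟩ := (csInf_mem hne).2 hw z hz
  exact ⟨z', hz', hw', hd.trans h⟩

theorem elementTameDegree_le {a : M} {w : FactMonoid M} {N : ℕ∞} (hN : N ≠ 1)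
    (h : IsTameBound a w N) : elementTameDegree a w ≤ N :=
  sInf_le ⟨hN, h⟩

theorem isTameBound_of_tameDegree_le {A : Set M} {X : Set (FactMonoid M)} {N : ℕ∞}
    (h : tameDegree A X ≤ N) {a : M} (ha : a ∈ A) {w : FactMonoid M} (hw : w ∈ X) :
    IsTameBound a w N := by
  refine isTameBound_of_elementTameDegree_le (le_trans ?_ h)
  exact le_iSup₂_of_le a ha (le_iSup₂_of_le w hw le_rfl)

end CommMonoid

/-! ### Finiteness in locally tame monoids -/

section CancelCommMonoid

variable {S : Type*} [CancelCommMonoid S]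

theorem associates_mul_left_cancel {p q r : Associates S} (h : p * q = p * r) : q = r := by
  obtain ⟨a, rfl⟩ := Associates.mk_surjective p
  obtain ⟨b, rfl⟩ := Associates.mk_surjective q
  obtain ⟨c, rfl⟩ := Associates.mk_surjective r
  rw [Associates.mk_mul_mk, Associates.mk_mul_mk, Associates.mk_eq_mk_iff_associated] at h
  obtain ⟨u, hu⟩ := h
  rw [mul_assoc] at hu
  exact Associates.mk_eq_mk_iff_associated.2 ⟨u, mul_left_cancel hu⟩

theorem mem_factorizations_of_add_mem {a b : S} {w z z' : FactMonoid S}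
    (h : w + z ∈ factorizations a) (h' : w + z' ∈ factorizations a)
    (hz : z ∈ factorizations b) : z' ∈ factorizations b := by
  rw [mem_factorizations] at *
  rw [Multiset.map_add, Multiset.prod_add] at h h'
  rw [← hz]
  exact associates_mul_left_cancel (h'.trans h.symm)

/-- Replacing a part `w` of a factorization by another factorization `w'` of the same element. -/
theorem add_mem_factorizations_of_add_mem {a b : S} {w w' y : FactMonoid S}
    (h : w + y ∈ factorizations a) (hw : w ∈ factorizations b) (hw' : w' ∈ factorizations b) :
    w' + y ∈ factorizations a := by
  rw [mem_factorizations] at *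
  rw [Multiset.map_add, Multiset.prod_add, hw] at h
  rw [Multiset.map_add, Multiset.prod_add, hw', h]

theorem IsLocallyTame.exists_isTameBound_singleton (h : IsLocallyTame S)
    (u : {p : Associates S // Irreducible p}) : ∃ N : ℕ, ∀ a : S, IsTameBound a {u} N := by
  obtain ⟨N, hN⟩ := ENat.ne_top_iff_exists.1 (h u).ne
  exact ⟨N, fun a => isTameBound_of_tameDegree_le hN.ge (Set.mem_univ a) rfl⟩

/-- In a locally tame monoid the tame degree with respect to any element of the factorization monoid
is finite: the atoms of `w` can be brought into a factorization one after the other. -/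
theorem IsLocallyTame.exists_isTameBound (h : IsLocallyTame S) (w : FactMonoid S) :
    ∃ N : ℕ, ∀ a : S, IsTameBound a w N := by
  induction w using Multiset.induction with
  | empty =>
    refine ⟨0, fun a _ z hz => ⟨z, hz, Multiset.zero_le z, ?_⟩⟩
    classical
    simp [factDist_eq]
  | cons u w ih =>
    obtain ⟨N, hN⟩ := ih
    obtain ⟨N', hN'⟩ := h.exists_isTameBound_singleton u
    refine ⟨N' + N, fun a ⟨z₀, hz₀, hw⟩ z hz => ?_⟩
    rw [← Multiset.singleton_add] at hw ⊢
    obtain ⟨y₀, rfl⟩ := le_iff_exists_add.1 hw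
    rw [add_assoc] at hz₀
    obtain ⟨z₁, hz₁, hu, hd⟩ := hN' a ⟨_, hz₀, le_self_add⟩ z hz
    obtain ⟨y, rfl⟩ := le_iff_exists_add.1 hu
    obtain ⟨b, hb⟩ := exists_mem_factorizations (w + y₀)
    have hy := mem_factorizations_of_add_mem hz₀ hz₁ hb
    obtain ⟨y', hy', hw', hd'⟩ := hN b ⟨_, hb, le_self_add⟩ y hy
    refine ⟨{u} + y', ?_, add_le_add_right hw' _, ?_⟩
    · rw [add_comm] at hz₁ ⊢
      exact add_mem_factorizations_of_add_mem hz₁ hy hy'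
    · have h1 := factDist_triangle z ({u} + y) ({u} + y')
      rw [factDist_add_left] at h1
      have h2 : factDist z ({u} + y) ≤ N' := by exact_mod_cast hd
      have h3 : factDist y y' ≤ N := by exact_mod_cast hd'
      exact_mod_cast h1.trans (add_le_add h2 h3)

/-- The lengths of the factorizations of an element of a locally tame monoid are bounded. By
induction on one factorization `u + z` of the element: an arbitrary factorization is close
to one that contains the atom `u`. -/
theorem IsLocallyTame.exists_card_le (h : IsLocallyTame S) (z : FactMonoid S) :
    ∃ N : ℕ, ∀ a : S, z ∈ factorizations a → ∀ z' ∈ factorizations a, Multiset.card z' ≤ N := by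
  induction z using Multiset.induction with
  | empty =>
    refine ⟨0, fun a hz z' hz' => ?_⟩
    have ha : IsUnit a := by
      rw [mem_factorizations, Multiset.map_zero, Multiset.prod_zero] at hz
      exact Associates.mk_eq_one.1 hz.symm
    rw [eq_zero_of_mem_factorizations ha hz', Multiset.card_zero]
  | cons u z ih =>
    obtain ⟨N, hN⟩ := ih
    obtain ⟨N', hN'⟩ := h.exists_isTameBound_singleton u
    refine ⟨1 + N + N', fun a hz z' hz' => ?_⟩
    rw [← Multiset.singleton_add] at hz
    obtain ⟨z₁, hz₁, hu, hd⟩ := hN' a ⟨_, hz, le_self_add⟩ z' hz'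
    obtain ⟨y, rfl⟩ := le_iff_exists_add.1 hu
    obtain ⟨b, hb⟩ := exists_mem_factorizations z
    have h1 := hN b hb y (mem_factorizations_of_add_mem hz hz₁ hb)
    have h2 := (card_le_card_add_factDist z' ({u} + y)).1
    have h3 : factDist z' ({u} + y) ≤ N' := by exact_mod_cast hd
    rw [Multiset.card_add, Multiset.card_singleton] at h2
    omega

theorem IsLocallyTame.exists_forall_card_le (h : IsLocallyTame S) (hat : IsAtomicMonoid S) (a : S) :
    ∃ N : ℕ, ∀ z ∈ factorizations a, Multiset.card z ≤ N := by
  obtain ⟨z, hz⟩ := factorizations_nonempty hat a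
  obtain ⟨N, hN⟩ := h.exists_card_le z
  exact ⟨N, hN a hz⟩

theorem IsLocallyTame.finite_factorizationLengths (h : IsLocallyTame S) (hat : IsAtomicMonoid S)
    (a : S) : (factorizationLengths a).Finite := by
  obtain ⟨N, hN⟩ := h.exists_forall_card_le hat a
  refine (Set.finite_Iic N).subset ?_
  rintro _ ⟨z, hz, rfl⟩
  exact hN z hz

/-- The tame degree with respect to all factorizations of a fixed element `b` is finite, although
there may be infinitely many of them: it suffices to bring one factorization of `b` into a given
factorization, and to exchange it for the desired one, which costs at most `max L(b)`. -/
theorem IsLocallyTame.tameDegree_factorizations_ne_top (h : IsLocallyTame S)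
    (hat : IsAtomicMonoid S) (A : Set S) (b : S) : tameDegree A (factorizations b) ≠ ⊤ := by
  obtain ⟨B, hB⟩ := h.exists_forall_card_le hat b
  obtain ⟨w₀, hw₀⟩ := factorizations_nonempty hat b
  obtain ⟨N, hN⟩ := h.exists_isTameBound w₀
  have key : tameDegree A (factorizations b) ≤ ((N + B + 2 : ℕ) : ℕ∞) := by
    refine iSup₂_le fun a _ => iSup₂_le fun w hw => elementTameDegree_le ?_ ?_
    · exact_mod_cast (by omega : N + B + 2 ≠ 1)
    rintro ⟨z₀, hz₀, hle⟩ z hz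
    obtain ⟨y₀, rfl⟩ := le_iff_exists_add.1 hle
    obtain ⟨z₁, hz₁, hle₁, hd⟩ :=
      hN a ⟨_, add_mem_factorizations_of_add_mem hz₀ hw hw₀, le_self_add⟩ z hz
    obtain ⟨y, rfl⟩ := le_iff_exists_add.1 hle₁
    refine ⟨w + y, add_mem_factorizations_of_add_mem hz₁ hw₀ hw, le_self_add, ?_⟩
    have h1 := factDist_triangle z (w₀ + y) (w + y)
    rw [add_comm w₀ y, add_comm w y, factDist_add_left, add_comm y w₀, add_comm y w] at h1
    have h2 := factDist_le_max_card w₀ w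
    have h3 : factDist z (w₀ + y) ≤ N := by exact_mod_cast hd
    have h4 := max_le (hB w₀ hw₀) (hB w hw)
    exact_mod_cast (by omega : factDist z (w + y) ≤ N + B + 2)
  exact ne_top_of_le_ne_top (ENat.natCast_ne_top _) key

theorem isTame_pow (hat : IsAtomicMonoid S) {A : Set S} {x : S} (hA : ∀ k, x ^ k ∈ A) {ψ T : ℕ}
    (hT : tameDegree A (factorizations (x ^ ψ)) ≤ T) :
    IsLengthFamily.IsTame (fun k => factorizationLengths (x ^ k)) ψ T := by
  rintro k _ _ ⟨w, hw, rfl⟩ ⟨z, hz, rfl⟩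
  obtain ⟨v, hv⟩ := factorizations_nonempty hat (x ^ k)
  have hwv := add_mem_factorizations hw hv
  rw [← pow_add] at hwv
  obtain ⟨z', hz', hle, hd⟩ :=
    isTameBound_of_tameDegree_le hT (hA (ψ + k)) hw ⟨_, hwv, le_self_add⟩ z hz
  obtain ⟨y, rfl⟩ := le_iff_exists_add.1 hle
  refine ⟨_, ⟨y, mem_factorizations_of_add_mem hwv hz' hv, rfl⟩, ?_⟩
  have h1 := card_le_card_add_factDist z (w + y)
  have h2 : factDist z (w + y) ≤ T := by exact_mod_cast hd
  rw [Multiset.card_add] at h1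
  omega

end CancelCommMonoid

/-! ### Divisor-closed submonoids -/

section DivisorClosed

variable {S : Type*} [CommMonoid S] {K : Submonoid S}

/-- A submonoid that contains all divisors of its elements. -/
def IsDivisorClosed (K : Submonoid S) : Prop :=
  ∀ ⦃a b : S⦄, a ∣ b → b ∈ K → a ∈ K

theorem isDivisorClosed_divisorClosure (x : S) : IsDivisorClosed (divisorClosure x) :=
  fun _ _ hab ⟨k, hk⟩ => ⟨k, hab.trans hk⟩

/-- The homomorphism of reduced monoids induced by the inclusion of a submonoid. -/
def associatesMap (K : Submonoid S) : Associates K →* Associates S where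
  toFun := Quotient.map' (fun a : K => (a : S)) fun _ _ h => Associated.map K.subtype h
  map_one' := rfl
  map_mul' := by
    rintro ⟨a⟩ ⟨b⟩
    rfl

theorem associatesMap_mk (a : K) : associatesMap K (Associates.mk a) = Associates.mk (a : S) :=
  rfl

theorem IsDivisorClosed.isUnit_coe_iff (hK : IsDivisorClosed K) {a : K} :
    IsUnit (a : S) ↔ IsUnit a := by
  refine ⟨fun h => ?_, fun h => h.map K.subtype⟩
  obtain ⟨b, hb⟩ := h.exists_right_inv
  have hbK : b ∈ K := hK ⟨a, by rw [mul_comm, hb]⟩ K.one_mem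
  exact IsUnit.of_mul_eq_one ⟨b, hbK⟩ (Subtype.ext hb)

theorem IsDivisorClosed.irreducible_coe_iff (hK : IsDivisorClosed K) {a : K} :
    Irreducible (a : S) ↔ Irreducible a := by
  rw [irreducible_iff, irreducible_iff, hK.isUnit_coe_iff]
  refine and_congr_right fun _ => ⟨fun h b c hbc => ?_, fun h b c hbc => ?_⟩
  · rw [← hK.isUnit_coe_iff, ← hK.isUnit_coe_iff]
    exact h (by rw [hbc, Submonoid.coe_mul])
  · have hb : b ∈ K := hK ⟨c, hbc⟩ a.2
    have hc : c ∈ K := hK ⟨b, by rw [hbc, mul_comm]⟩ a.2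
    exact (h (a := ⟨b, hb⟩) (b := ⟨c, hc⟩) (Subtype.ext hbc)).imp hK.isUnit_coe_iff.2
      hK.isUnit_coe_iff.2

theorem IsDivisorClosed.associatesMap_injective (hK : IsDivisorClosed K) :
    Function.Injective (associatesMap K) := by
  intro p q h
  obtain ⟨a, rfl⟩ := Associates.mk_surjective p
  obtain ⟨b, rfl⟩ := Associates.mk_surjective q
  rw [associatesMap_mk, associatesMap_mk, Associates.mk_eq_mk_iff_associated] at h
  obtain ⟨u, hu⟩ := h
  have huK : (u : S) ∈ K := hK u.isUnit.dvd K.one_mem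
  obtain ⟨v, hv⟩ := (hK.isUnit_coe_iff (a := ⟨u, huK⟩)).1 u.isUnit
  exact Associates.mk_eq_mk_iff_associated.2 ⟨v, Subtype.ext (by rw [hv]; exact hu)⟩

theorem IsDivisorClosed.irreducible_associatesMap (hK : IsDivisorClosed K) {p : Associates K}
    (hp : Irreducible p) : Irreducible (associatesMap K p) := by
  obtain ⟨a, rfl⟩ := Associates.mk_surjective p
  rw [associatesMap_mk, irreducible_associates_mk, hK.irreducible_coe_iff]
  exact irreducible_associates_mk.1 hp

/-- The inclusion of the atoms of a divisor-closed submonoid. -/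
def IsDivisorClosed.atomMap (hK : IsDivisorClosed K) (p : {p : Associates K // Irreducible p}) :
    {p : Associates S // Irreducible p} :=
  ⟨associatesMap K p, hK.irreducible_associatesMap p.2⟩

theorem IsDivisorClosed.atomMap_injective (hK : IsDivisorClosed K) :
    Function.Injective hK.atomMap := fun _ _ h =>
  Subtype.ext (hK.associatesMap_injective (congrArg Subtype.val h))

theorem IsDivisorClosed.mem_range_atomMap (hK : IsDivisorClosed K) {a : S} (ha : a ∈ K)
    {p : {p : Associates S // Irreducible p}} (hp : p.1 ∣ Associates.mk a) :
    p ∈ Set.range hK.atomMap := by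
  obtain ⟨p, hirr⟩ := p
  obtain ⟨b, rfl⟩ := Associates.mk_surjective p
  have hb : b ∈ K := hK (Associates.mk_dvd_mk.1 hp) ha
  exact ⟨⟨Associates.mk ⟨b, hb⟩, irreducible_associates_mk.2
    (hK.irreducible_coe_iff.1 (irreducible_associates_mk.1 hirr))⟩, rfl⟩

theorem IsDivisorClosed.map_mem_factorizations_iff (hK : IsDivisorClosed K) {a : K}
    {z : FactMonoid K} : z.map hK.atomMap ∈ factorizations (a : S) ↔ z ∈ factorizations a := by
  have h : ((z.map hK.atomMap).map Subtype.val).prod =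
      associatesMap K (z.map Subtype.val).prod := by
    rw [Multiset.map_map, map_multiset_prod, Multiset.map_map]
    rfl
  rw [mem_factorizations, mem_factorizations, h, ← associatesMap_mk,
    hK.associatesMap_injective.eq_iff]

theorem IsDivisorClosed.factorizations_coe (hK : IsDivisorClosed K) (a : K) :
    factorizations (a : S) = Multiset.map hK.atomMap '' factorizations a := by
  refine Set.Subset.antisymm (fun z hz => ?_) ?_
  · have hmem : ∀ p ∈ z, ∃ q, hK.atomMap q = p := fun p hp =>
      hK.mem_range_atomMap a.2 (by
        rw [← mem_factorizations.1 hz]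
        exact Multiset.dvd_prod (Multiset.mem_map_of_mem _ hp))
    have : CanLift _ _ hK.atomMap fun p => ∃ q, hK.atomMap q = p := ⟨fun _ h => h⟩
    lift z to FactMonoid K using hmem
    exact ⟨z, hK.map_mem_factorizations_iff.1 hz, rfl⟩
  · rintro _ ⟨z, hz, rfl⟩
    exact hK.map_mem_factorizations_iff.2 hz

theorem IsDivisorClosed.factorizationLengths_coe (hK : IsDivisorClosed K) (a : K) :
    factorizationLengths (a : S) = factorizationLengths a := by
  rw [factorizationLengths, factorizationLengths, hK.factorizations_coe, Set.image_image]
  simp only [Multiset.card_map]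

theorem IsDivisorClosed.deltaSet_coe (hK : IsDivisorClosed K) (a : K) :
    deltaSet (a : S) = deltaSet a := by
  rw [deltaSet_eq, deltaSet_eq, hK.factorizationLengths_coe]

theorem card_map_sub_map {α β : Type*} [DecidableEq α] [DecidableEq β] {f : α → β}
    (hf : Function.Injective f) (s t : Multiset α) :
    Multiset.card (s.map f - t.map f) = Multiset.card (s - t) := by
  have : s.map f - t.map f = (s - t).map f := by
    ext b
    by_cases hb : ∃ a, f a = b
    · obtain ⟨a, rfl⟩ := hb
      simp only [Multiset.count_sub, Multiset.count_map_eq_count' f _ hf]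
    · have h : ∀ u : Multiset α, (u.map f).count b = 0 := fun u =>
        Multiset.count_eq_zero.2 fun hu => hb <| by
          obtain ⟨a, -, ha⟩ := Multiset.mem_map.1 hu
          exact ⟨a, ha⟩
      rw [Multiset.count_sub, h, h, h]
  rw [this, Multiset.card_map]

theorem IsDivisorClosed.factDist_map (hK : IsDivisorClosed K) (z z' : FactMonoid K) :
    factDist (z.map hK.atomMap) (z'.map hK.atomMap) = factDist z z' := by
  classical
  rw [factDist_eq, factDist_eq, card_map_sub_map hK.atomMap_injective,
    card_map_sub_map hK.atomMap_injective]

theorem IsDivisorClosed.elementTameDegree_coe (hK : IsDivisorClosed K) (a : K)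
    (w : FactMonoid K) :
    elementTameDegree (a : S) (w.map hK.atomMap) = elementTameDegree a w := by
  simp only [elementTameDegree, hK.factorizations_coe, Set.exists_mem_image, Set.forall_mem_image,
    hK.factDist_map, Multiset.map_le_map_iff hK.atomMap_injective]

theorem IsDivisorClosed.tameDegree_coe (hK : IsDivisorClosed K) (b : K) :
    tameDegree (K : Set S) (factorizations (b : S)) =
      tameDegree (Set.univ : Set K) (factorizations b) := by
  simp only [tameDegree, hK.factorizations_coe b, iSup_image, iSup_univ, SetLike.mem_coe,
    ← hK.elementTameDegree_coe, iSup_subtype]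

theorem monoidDeltaSet_divisorClosure (x : S) :
    monoidDeltaSet (divisorClosure x) = ⋃ a ∈ divisorClosure x, deltaSet a := by
  ext δ
  simp only [monoidDeltaSet, Set.mem_iUnion,
    ← (isDivisorClosed_divisorClosure x).deltaSet_coe, Subtype.exists, exists_prop]

end DivisorClosed

/-! ### The minimal distance -/

/-- The minimal distance of a monoid divides all distances: if `l, l + d` are lengths of `b` and
`k, k + (q * d + r)` are lengths of `a`, then `b ^ q * a` has two lengths with difference `r`. -/
theorem dvd_of_isLeast_distances {M : Type*} [CommMonoid M] {K : Submonoid M} {d : ℕ}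
    (hd : IsLeast (⋃ a ∈ K, deltaSet a) d) {δ : ℕ} (hδ : δ ∈ ⋃ a ∈ K, deltaSet a) : d ∣ δ := by
  obtain ⟨hdmem, hmin⟩ := hd
  simp only [Set.mem_iUnion, exists_prop, deltaSet_eq] at hdmem hδ
  obtain ⟨b, hbK, hd0, l, hl, hld, -⟩ := hdmem
  obtain ⟨a, haK, -, k, hk, hkδ, -⟩ := hδ
  rcases Nat.eq_zero_or_pos (δ % d) with h | h
  · exact Nat.dvd_of_mod_eq_zero h
  exfalso
  have hL := isLengthFamily_pow b
  have hmul : ∀ i ∈ factorizationLengths b, ∀ v : ℕ, v * i ∈ factorizationLengths (b ^ v) :=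
    fun i hi v => by simpa using hL.mul_mem (u := 1) (q := i) (by simpa using hi) v
  have h1 := add_mem_factorizationLengths (hmul _ hld (δ / d)) hk
  have h2 := add_mem_factorizationLengths (hmul _ hl (δ / d)) hkδ
  have e : δ / d * l + (k + δ) = δ / d * (l + d) + k + δ % d := by
    have := Nat.div_add_mod' δ d
    rw [mul_add]
    linarith
  rw [e] at h2
  obtain ⟨δ', hδ', hle, -⟩ := exists_mem_distances_le h1 h h2
  have : d ≤ δ' := hmin (by
    simp only [Set.mem_iUnion, exists_prop, deltaSet_eq]
    exact ⟨_, K.mul_mem (K.pow_mem hbK _) haK, hδ'⟩)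
  have := Nat.mod_lt δ hd0
  omega

/-- A distance that occurs in a divisor of a power of `x` and is minimal among such distances
occurs in a power of `x`. -/
theorem exists_mem_deltaSet_pow {M : Type*} [CommMonoid M] (hat : IsAtomicMonoid M) {x : M} {d : ℕ}
    (hd : IsLeast (⋃ a ∈ divisorClosure x, deltaSet a) d) : ∃ k, d ∈ deltaSet (x ^ k) := by
  have hdmem := hd.1
  simp only [Set.mem_iUnion, exists_prop, deltaSet_eq] at hdmem
  obtain ⟨a, ⟨k, b, hk⟩, hd0, l, hl, hld, -⟩ := hdmem
  obtain ⟨w, hw⟩ := factorizations_nonempty hat b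
  have hj : Multiset.card w ∈ factorizationLengths b := ⟨w, hw, rfl⟩
  have h1 := add_mem_factorizationLengths hl hj
  have h2 := add_mem_factorizationLengths hld hj
  rw [← hk] at h1 h2
  rw [add_right_comm] at h2
  obtain ⟨δ, hδ, hle, -⟩ := exists_mem_distances_le h1 hd0 h2
  rw [← deltaSet_eq] at hδ
  have hdδ : d ≤ δ := hd.2 (by
    simp only [Set.mem_iUnion, exists_prop]
    exact ⟨x ^ k, ⟨k, dvd_rfl⟩, hδ⟩)
  exact ⟨k, by rwa [le_antisymm hdδ hle]⟩

end Factorization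

/-! ### The length density of powers -/

open Factorization in
theorem mainTheorem2 {S : Type*} [CancelCommMonoid S]
    (hatomic : Factorization.IsAtomicMonoid S) (htame : Factorization.IsLocallyTame S)
    (x : S) (hx : (Factorization.deltaSet x).Nonempty)
    (hfin : (Factorization.monoidDeltaSet (Factorization.divisorClosure x)).Finite) :
    ∃ d τ ψ T : ℕ,
      -- `d = min Δ(H)` with `H = ⟦x⟧` regarded as a monoid of its own
      IsLeast (Factorization.monoidDeltaSet (Factorization.divisorClosure x)) d ∧
      -- `τ` is minimal with `d ∈ Δ(x ^ τ)`
      IsLeast {k : ℕ | d ∈ Factorization.deltaSet (x ^ k)} τ ∧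
      -- `ψ = max (τ, ρ(Δ(H)) - 1)`
      (ψ : ℝ) = max (τ : ℝ) (Factorization.setElasticity
        (Factorization.monoidDeltaSet (Factorization.divisorClosure x)) - 1) ∧
      -- `T = t(H, Z_S(x ^ ψ)) < ∞`, whether the tame degree is taken in `S` or in `H`
      Factorization.tameDegree (Factorization.divisorClosure x : Set S)
        (Factorization.factorizations (x ^ ψ)) = (T : ℕ∞) ∧
      Factorization.tameDegree (Set.univ : Set (Factorization.divisorClosure x))
        (Factorization.factorizations
          ((⟨x, Factorization.self_mem_divisorClosure x⟩ : Factorization.divisorClosure x) ^ ψ))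
        = (T : ℕ∞) ∧
      -- the length density of `x ^ n` is defined for all `n ≥ 1`
      (∀ n : ℕ, 1 ≤ n → (Factorization.lengthSet (x ^ n)).Finite ∧
        0 < Factorization.lengthSpread (x ^ n)) ∧
      (∀ n : ℕ, ψ ≤ n →
        1 / (d : ℝ) - 2 * (T : ℝ) / ((n : ℝ) * (d : ℝ) ^ 2)
            ≤ Factorization.lengthDensity (x ^ n) ∧
        Factorization.lengthDensity (x ^ n) ≤ 1 / (d : ℝ)) ∧
      Filter.Tendsto (fun n : ℕ => Factorization.lengthDensity (x ^ n)) Filter.atTop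
        (nhds (1 / (d : ℝ))) := by
  have hK := isDivisorClosed_divisorClosure x
  have hxunit := not_isUnit_of_deltaSet_nonempty hx
  have hxK : x ∈ divisorClosure x := self_mem_divisorClosure x
  set Δ := monoidDeltaSet (divisorClosure x) with hΔdef
  have hΔ : Δ = ⋃ a ∈ divisorClosure x, deltaSet a := monoidDeltaSet_divisorClosure x
  have hmemΔ : ∀ {δ k : ℕ}, δ ∈ deltaSet (x ^ k) → δ ∈ Δ := by
    intro δ k h
    rw [hΔ]
    simp only [Set.mem_iUnion, exists_prop]
    exact ⟨x ^ k, ⟨k, dvd_rfl⟩, h⟩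
  have hpos : ∀ {δ}, δ ∈ Δ → 0 < δ := by
    intro δ h
    obtain ⟨a, ha⟩ := Set.mem_iUnion.1 h
    exact ha.1
  obtain ⟨δ₀, hδ₀⟩ := hx
  have hδ₀Δ : δ₀ ∈ Δ := hmemΔ (k := 1) (by rwa [pow_one])
  have hne : Δ.Nonempty := ⟨δ₀, hδ₀Δ⟩
  have hdleast : IsLeast Δ (sInf Δ) := ⟨Nat.sInf_mem hne, fun _ h => Nat.sInf_le h⟩
  have hDmem : sSup Δ ∈ Δ := Nat.sSup_mem hne hfin.bddAbove
  have hdvdΔ : ∀ {δ}, δ ∈ Δ → sInf Δ ∣ δ := fun {δ} h =>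
    dvd_of_isLeast_distances (K := divisorClosure x) (hΔ ▸ hdleast) (hΔ ▸ h)
  set d := sInf Δ with hd_def
  have hd : 0 < d := hpos hdleast.1
  obtain ⟨m, hm⟩ := hdvdΔ hDmem
  have hm0 : 0 < m := by
    rcases Nat.eq_zero_or_pos m with rfl | h
    · have := hpos hDmem
      simp [hm] at this
    · exact h
  have hτne : {k : ℕ | d ∈ deltaSet (x ^ k)}.Nonempty :=
    exists_mem_deltaSet_pow hatomic (hΔ ▸ hdleast)
  set τ := sInf {k : ℕ | d ∈ deltaSet (x ^ k)} with hτ_def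
  have hτleast : IsLeast {k : ℕ | d ∈ deltaSet (x ^ k)} τ :=
    ⟨Nat.sInf_mem hτne, fun _ h => Nat.sInf_le h⟩
  have hτpos : 0 < τ := by
    rcases Nat.eq_zero_or_pos τ with h | h
    · have h1 : d ∈ deltaSet (x ^ τ) := hτleast.1
      rw [h, pow_zero] at h1
      exact absurd isUnit_one (not_isUnit_of_deltaSet_nonempty ⟨d, h1⟩)
    · exact h
  set ψ := max τ (m - 1) with hψ
  obtain ⟨T, hT⟩ := ENat.ne_top_iff_exists.1
    (htame.tameDegree_factorizations_ne_top hatomic (divisorClosure x : Set S) (x ^ ψ))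
  -- The sets of lengths of the powers of `x`.
  have hL := isLengthFamily_pow x
  have hLfin : ∀ k, (factorizationLengths (x ^ k)).Finite := fun k =>
    htame.finite_factorizationLengths hatomic _
  have hLne : ∀ k, (factorizationLengths (x ^ k)).Nonempty := fun k =>
    (factorizations_nonempty hatomic _).image _
  have hLΔ : ∀ {k δ}, δ ∈ distances (factorizationLengths (x ^ k)) → δ ∈ Δ := fun {k δ} h =>
    hmemΔ (k := k) (by rwa [deltaSet_eq])
  have hLdvd : ∀ k, ∀ δ ∈ distances (factorizationLengths (x ^ k)), d ∣ δ :=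
    fun k δ h => hdvdΔ (hLΔ h)
  have hLle : ∀ k, ∀ δ ∈ distances (factorizationLengths (x ^ k)), δ ≤ m * d := by
    intro k δ h
    rw [mul_comm, ← hm]
    exact le_csSup hfin.bddAbove (hLΔ h)
  have hLtame := isTame_pow hatomic (fun k => (divisorClosure x).pow_mem hxK k) hT.ge
  obtain ⟨p, σ, hσ, hp, hpσ⟩ : ∃ p σ, 0 < σ ∧ p ∈ factorizationLengths (x ^ 1) ∧
      p + σ * d ∈ factorizationLengths (x ^ 1) := by
    obtain ⟨σ, rfl⟩ := hdvdΔ hδ₀Δ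
    rw [deltaSet_eq] at hδ₀
    obtain ⟨h0, p, hp, hp', -⟩ := hδ₀
    rw [pow_one]
    exact ⟨p, σ, Nat.pos_of_mul_pos_left h0, hp, by rwa [mul_comm σ]⟩
  obtain ⟨l, hl, hld⟩ : ∃ l, l ∈ factorizationLengths (x ^ τ) ∧
      l + d ∈ factorizationLengths (x ^ τ) := by
    have h : d ∈ deltaSet (x ^ τ) := hτleast.1
    rw [deltaSet_eq] at h
    obtain ⟨-, l, h1, h2, -⟩ := h
    exact ⟨l, h1, h2⟩
  have hspread : ∀ n, 0 < n →
      0 < sSup (factorizationLengths (x ^ n)) - sInf (factorizationLengths (x ^ n)) := fun n hn =>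
    lt_of_lt_of_le (by positivity) (hL.le_csSup_sub_csInf hLfin hp hpσ n)
  have hbounds : ∀ n : ℕ, ψ ≤ n →
      1 / (d : ℝ) - 2 * (T : ℝ) / ((n : ℝ) * (d : ℝ) ^ 2) ≤ lengthDensity (x ^ n) ∧
        lengthDensity (x ^ n) ≤ 1 / (d : ℝ) := by
    intro n hn
    have hn0 : 0 < n := hτpos.trans_le ((le_max_left _ _).trans hn)
    rw [lengthDensity, lengthSpread, lengthSet_pow hxunit]
    exact ⟨hL.le_density hLfin hLne hd hσ hLdvd hLle hp hpσ hl hld (le_max_left _ _)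
      (by omega) hLtame hn0, density_le hd (hLfin n) (hLne n) (hspread n hn0) (hLdvd n)⟩
  refine ⟨d, τ, ψ, T, hdleast, hτleast, ?_, hT.symm, ?_, fun n hn => ?_, hbounds, ?_⟩
  · have hd' : (d : ℝ) ≠ 0 := by exact_mod_cast hd.ne'
    rw [setElasticity, ← hd_def, hm, Nat.cast_mul, mul_div_cancel_left₀ _ hd', hψ, Nat.cast_max,
      Nat.cast_sub hm0, Nat.cast_one]
  · rw [hT, ← hK.tameDegree_coe, SubmonoidClass.coe_pow]
  · rw [lengthSpread, lengthSet_pow hxunit]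
    exact ⟨hLfin n, hspread n hn⟩
  · have hlim : Filter.Tendsto
        (fun n : ℕ => 1 / (d : ℝ) - 2 * (T : ℝ) / ((n : ℝ) * (d : ℝ) ^ 2)) Filter.atTop
        (nhds (1 / (d : ℝ))) := by
      have h := (tendsto_const_div_atTop_nhds_zero_nat (2 * (T : ℝ) / (d : ℝ) ^ 2)).const_sub
        (1 / (d : ℝ))
      rw [sub_zero] at h
      refine h.congr fun n => ?_
      rw [div_div, mul_comm ((d : ℝ) ^ 2)]
    refine tendsto_of_tendsto_of_tendsto_of_le_of_le' hlim tendsto_const_nhds ?_ ?_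
    · filter_upwards [Filter.eventually_ge_atTop ψ] with n hn using (hbounds n hn).1
    · filter_upwards [Filter.eventually_ge_atTop ψ] with n hn using (hbounds n hn).2
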